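/- Let $\mathcal O$ be a Dedekind domain, $\pi\in\mathcal O$ a generator of a non-zero prime ideal $\mathfrak p$ with finite residue field $k=\mathcal O/\mathfrak p$, and $q=|k|$. Equip $\mathcal O$ with $\delta(x)=\pi^{-1}(x-x^q)$. Let $R_*=(R_0\to R_1\to R_2\to\cdots)$ be a prolongation sequence over $\mathcal O$: $\mathcal O$-algebras $R_i$, $\mathcal O$-algebra maps $u_i\colon R_i\to R_{i+1}$ and maps $\delta_i\colon R_i\to R_{i+1}$ with $$\delta_i(x+y)=\delta_i(x)+\delta_i(y)+C_\pi(u_i(x),u_i(y)),\qquad \delta_i(xy)=u_i(x)^q\delta_i(y)+u_i(y)^q\delta_i(x)+\pi\,\delta_i(x)\delta_i(y),$$ where $C_\pi(X,Y)=\pi^{-1}(X^q+Y^q-(X+Y)^q)\in\mathcal O[X,Y]$, such that $u_{i+1}\circ\delta_i=\delta_{i+1}\circ u_i$ and $\delta_i$ is compatible with $\delta$ through the structure maps of $R_i$ and $R_{i+1}$. For an $\mathcal O$-algebra $B$ let $W_n(B)$ be the ring of truncated $\pi$-typical Witt vectors: $W_n(B)=B^{n+1}$ as a set, with the ring structure,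 functorial in $B$, for which the Witt polynomials $w_i=\sum_{j=0}^{i}\pi^jx_j^{q^{i-j}}$, $0\le i\le n$, are ring homomorphisms $W_n(B)\to B$. For an $R_n$-algebra $B$, regard $W_n(B)$ as an $R_0$-algebra through the canonical ring homomorphism $R_0\to W_n(R_n)$, $c\mapsto (P_0(c),\dots,P_n(c))$, followed by $W_n(R_n)\to W_n(B)$. Here $P_i(c)=P_i(c,\delta c,\dots,\delta^ic)$, computed in $R_n$, and the polynomials $P_i\in\mathcal O[T,T',\dots,T^{(i)}]$ are determined by $\sum_{j=0}^i\pi^jP_j^{q^{i-j}}=\phi^i(T)$, where $\phi$ is the $\mathcal O$-algebra endomorphism $T^{(j)}\mapsto (T^{(j)})^q+\pi T^{(j+1)}$. For a ring $R$, consider sheaves of sets for the étale topology on the category of affine $R$-schemes. For a sheaf $X$ on affine $R_0$-schemes and an $R_n$-algebra $B$ put $$J^nX(B)=X(W_n(B)),\qquad X^{(n)}(B)=X(B),$$ where in the second formula $B$ is an $R_0$-algebra through $R_0\to R_n$. The projection $W_n(B)\to B$, $(b_0,\dots,b_n)\mapsto b_0$, induces a natural map $J^nX\to X^{(n)}$.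 A map $f\colon X\to Y$ of sheaves on affine $R_0$-schemes is formally étale if for every nilpotent closed immersion $\bar T\to T$ of affine $R_0$-schemes the map $X(T)\to X(\bar T)\times_{Y(\bar T)}Y(T)$ is bijective. **Proposition 3.7.** Let $f\colon X\to Y$ be a formally étale map of sheaves on affine $R_0$-schemes. Then for all $n\ge 0$ and $m\ge 0$ the natural map $$J^nX\longrightarrow J^nY\times_{Y^{(n)}}X^{(n)}$$ becomes an isomorphism after base change along $\operatorname{Spec}(R_n/\pi^mR_n)\to\operatorname{Spec}R_n$; that is, it is bijective on $B$-sections for every $R_n/\pi^mR_n$-algebra $B$, naturally in $B$. -/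

import Mathlib

set_option linter.unusedSectionVars false

open CategoryTheory Limits Opposite

universe w u v

noncomputable section

namespace PiJet

/-! ### The base `(O, π)` -/

section Base

variable {O : Type u} [CommRing O] (π : O)

/-- The cardinality `q` of the residue field `O / (π)`. -/
def resCard : ℕ := Nat.card (O ⧸ Ideal.span {π})

variable [Fact (Prime π)] [Finite (O ⧸ Ideal.span {π})]

lemma resCard_eq_prime_pow :
    ∃ p h : ℕ, p.Prime ∧ 0 < h ∧ resCard π = p ^ h ∧ π ∣ (p : O) := by
  have hπ : Prime π := Fact.out
  have : (Ideal.span {π}).IsPrime := (Ideal.span_singleton_prime hπ.ne_zero).2 hπ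
  let : Field (O ⧸ Ideal.span {π}) := (Finite.isField_of_domain _).toField
  let : Fintype (O ⧸ Ideal.span {π}) := Fintype.ofFinite _
  obtain ⟨p, hc, h, hp, hcard⟩ := FiniteField.card' (O ⧸ Ideal.span {π})
  refine ⟨p, h, hp, h.2, by rw [resCard, Nat.card_eq_fintype_card, hcard], ?_⟩
  rw [← Ideal.mem_span_singleton, ← Ideal.Quotient.eq_zero_iff_mem, map_natCast]
  exact CharP.cast_eq_zero _ p

lemma one_lt_resCard : 1 < resCard π := by
  obtain ⟨p, h, hp, hh, hq, -⟩ := resCard_eq_prime_pow π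
  rw [hq]
  exact Nat.one_lt_pow hh.ne' hp.one_lt

lemma dvd_resCard : π ∣ (resCard π : O) := by
  obtain ⟨p, h, hp, hh, hq, hd⟩ := resCard_eq_prime_pow π
  rw [hq, Nat.cast_pow]
  exact dvd_pow hd hh.ne'

lemma dvd_choose {i : ℕ} (h0 : i ≠ 0) (h1 : i ≠ resCard π) : π ∣ ((resCard π).choose i : O) := by
  obtain ⟨p, h, hp, hh, hq, hd⟩ := resCard_eq_prime_pow π
  rw [hq] at h1 ⊢
  exact hd.trans (Nat.cast_dvd_cast (hp.dvd_choose_pow h0 h1))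

lemma dvd_sub_pow_resCard (x : O) : π ∣ x - x ^ resCard π := by
  have hπ : Prime π := Fact.out
  have : (Ideal.span {π}).IsPrime := (Ideal.span_singleton_prime hπ.ne_zero).2 hπ
  let : Field (O ⧸ Ideal.span {π}) := (Finite.isField_of_domain _).toField
  let : Fintype (O ⧸ Ideal.span {π}) := Fintype.ofFinite _
  rw [← Ideal.mem_span_singleton, ← Ideal.Quotient.eq_zero_iff_mem, map_sub, map_pow, resCard,
    Nat.card_eq_fintype_card, FiniteField.pow_card, sub_self]

/-- The `π`-derivation `δ x = (x - x ^ q) / π` of `O`. -/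
def delta (x : O) : O := (dvd_sub_pow_resCard π x).choose

lemma delta_spec (x : O) : x - x ^ resCard π = π * delta π x :=
  (dvd_sub_pow_resCard π x).choose_spec

lemma dvd_add_pow_sub {B : Type v} [CommRing B] [Algebra O B] (x y : B) :
    algebraMap O B π ∣ x ^ resCard π + y ^ resCard π - (x + y) ^ resCard π := by
  have hq := one_lt_resCard π
  obtain ⟨r, hr⟩ : ∃ r, resCard π = r + 1 := ⟨resCard π - 1, by omega⟩
  have key : (x + y) ^ resCard π = x ^ resCard π + y ^ resCard π +
      ∑ i ∈ Finset.range r, x ^ (i + 1) * y ^ (resCard π - (i + 1)) *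
        ((resCard π).choose (i + 1) : B) := by
    rw [add_pow, Finset.sum_range_succ, hr, Finset.sum_range_succ']
    simp
    ring
  rw [key, sub_add_cancel_left, dvd_neg]
  refine Finset.dvd_sum fun i hi => Dvd.dvd.mul_left ?_ _
  rw [Finset.mem_range] at hi
  have := dvd_choose π (i := i + 1) (by omega) (by omega)
  simpa using map_dvd (algebraMap O B) this

/-- The polynomial `C_π = (X ^ q + Y ^ q - (X + Y) ^ q) / π` with coefficients in `O`. -/
def cPoly : MvPolynomial (Fin 2) O :=
  (dvd_add_pow_sub π (MvPolynomial.X (R := O) (0 : Fin 2)) (MvPolynomial.X 1)).choose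

lemma cPoly_spec :
    (MvPolynomial.X 0 ^ resCard π + MvPolynomial.X 1 ^ resCard π
      - (MvPolynomial.X 0 + MvPolynomial.X 1) ^ resCard π : MvPolynomial (Fin 2) O)
      = algebraMap O _ π * cPoly π :=
  (dvd_add_pow_sub π (MvPolynomial.X (R := O) (0 : Fin 2)) (MvPolynomial.X 1)).choose_spec

lemma aeval_cPoly_spec {B : Type v} [CommRing B] [Algebra O B] (x y : B) :
    x ^ resCard π + y ^ resCard π - (x + y) ^ resCard π
      = algebraMap O B π * MvPolynomial.aeval ![x, y] (cPoly π) := by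
  have := congrArg (MvPolynomial.aeval ![x, y]) (cPoly_spec π)
  simpa using this

end Base

/-! ### Prolongation sequences -/

section Prolongation

variable {O : Type u} [CommRing O] (π : O) [Fact (Prime π)] [Finite (O ⧸ Ideal.span {π})]

/-- A `π`-derivation `δ : A → B` relative to an `O`-algebra homomorphism `f : A → B`. -/
structure IsPiDerivation {A B : Type v} [CommRing A] [CommRing B] [Algebra O A] [Algebra O B]
    (f : A →ₐ[O] B) (δ : A → B) : Prop where
  map_add : ∀ x y, δ (x + y) = δ x + δ y + MvPolynomial.aeval ![f x, f y] (cPoly π)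
  map_mul : ∀ x y, δ (x * y) =
    f x ^ resCard π * δ y + f y ^ resCard π * δ x + algebraMap O B π * δ x * δ y

/-- A prolongation sequence `C₀ ⇉ C₁ ⇉ C₂ ⇉ ⋯` over the constant prolongation sequence `O_*`. -/
structure ProlongationSequence where
  /-- The `O`-algebras `Cₙ`. -/
  obj : ℕ → Type v
  [commRing : ∀ n, CommRing (obj n)]
  [algebra : ∀ n, Algebra O (obj n)]
  /-- The algebra homomorphisms `uₙ : Cₙ → Cₙ₊₁`. -/
  u : ∀ n, obj n →ₐ[O] obj (n + 1)
  /-- The `π`-derivations `δₙ : Cₙ → Cₙ₊₁` relative to `uₙ`. -/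
  δ : ∀ n, obj n → obj (n + 1)
  isPiDerivation : ∀ n, IsPiDerivation π (u n) (δ n)
  /-- The compatibility `uₙ₊₁ ∘ δₙ = δₙ₊₁ ∘ uₙ`. -/
  u_δ : ∀ n x, u (n + 1) (δ n x) = δ (n + 1) (u n x)
  /-- The structure maps `O → Cₙ` form a morphism from `O_*`. -/
  δ_algebraMap : ∀ n (x : O), δ n (algebraMap O (obj n) x) = algebraMap O (obj (n + 1)) (delta π x)

attribute [instance] ProlongationSequence.commRing ProlongationSequence.algebra

end Prolongation

/-! ### Witt polynomials and ghost components -/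

section Ghost

variable {O : Type u} [CommRing O] (π : O)

/-- The ghost components `wᵢ(x) = ∑_{j ≤ i} π ^ j * x_j ^ (q ^ (i - j))`, for `0 ≤ i ≤ n`. -/
def ghost {n : ℕ} {B : Type v} [CommRing B] [Algebra O B] (x : Fin (n + 1) → B)
    (i : Fin (n + 1)) : B :=
  ∑ j ∈ Finset.Iic i, algebraMap O B π ^ (j : ℕ) * x j ^ resCard π ^ ((i : ℕ) - (j : ℕ))

/-- The ghost components of an infinite vector. -/
def ghostN {B : Type v} [CommRing B] [Algebra O B] (x : ℕ → B) (i : ℕ) : B :=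
  ∑ j ∈ Finset.range (i + 1), algebraMap O B π ^ j * x j ^ resCard π ^ (i - j)

section
variable {n : ℕ} {B : Type v} [CommRing B] [Algebra O B]

lemma ghost_val (x : ℕ → B) (i : Fin (n + 1)) :
    ghost π (fun j : Fin (n + 1) => x j) i = ghostN π x i := by
  unfold ghost ghostN
  have h : Finset.range ((i : ℕ) + 1) = (Finset.Iic i).map Fin.valEmbedding := by
    rw [Fin.map_valEmbedding_Iic]
    ext
    simp
  rw [h, Finset.sum_map]
  rfl

lemma exists_val_eq (x : Fin (n + 1) → B) : ∃ y : ℕ → B, (fun j : Fin (n + 1) => y j) = x :=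
  ⟨fun j => if h : j < n + 1 then x ⟨j, h⟩ else 0, by ext j; simp [j.2]⟩

lemma map_ghost {B' : Type w} [CommRing B'] [Algebra O B'] (f : B →ₐ[O] B')
    (x : Fin (n + 1) → B) (i : Fin (n + 1)) :
    f (ghost π x i) = ghost π (fun j => f (x j)) i := by
  simp [ghost]

lemma map_ghostN {B' : Type w} [CommRing B'] [Algebra O B'] (f : B →ₐ[O] B')
    (x : ℕ → B) (i : ℕ) :
    f (ghostN π x i) = ghostN π (fun j => f (x j)) i := by
  simp [ghostN]

lemma ghostN_succ (x : ℕ → B) (i : ℕ) :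
    ghostN π x (i + 1) = ghostN π (fun j => x j ^ resCard π) i
      + algebraMap O B π ^ (i + 1) * x (i + 1) := by
  unfold ghostN
  rw [Finset.sum_range_succ]
  simp only [Nat.sub_self, pow_zero, pow_one]
  congr 1
  refine Finset.sum_congr rfl fun j hj => ?_
  rw [Finset.mem_range] at hj
  rw [← pow_mul, ← pow_succ', show i + 1 - j = i - j + 1 by omega]

lemma ghost_injective (hB : IsLeftRegular (algebraMap O B π)) :
    Function.Injective (ghost π : (Fin (n + 1) → B) → Fin (n + 1) → B) := by
  intro x y h
  obtain ⟨x, rfl⟩ := exists_val_eq x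
  obtain ⟨y, rfl⟩ := exists_val_eq y
  have key : ∀ i : ℕ, i < n + 1 → x i = y i := by
    intro i
    induction i using Nat.strong_induction_on with
    | _ i ih =>
      intro hi
      have h1 := congrFun h ⟨i, hi⟩
      rw [ghost_val, ghost_val] at h1
      simp only [ghostN, Finset.sum_range_succ, Nat.sub_self, pow_zero, pow_one] at h1
      rw [Finset.sum_congr rfl (g := fun j => algebraMap O B π ^ j * y j ^ resCard π ^ (i - j))]
        at h1
      · exact (hB.pow i) (add_left_cancel h1)
      · intro j hj
        rw [Finset.mem_range] at hj
        rw [ih j hj (by omega)]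
  ext i
  exact key i i.2

end

variable [Fact (Prime π)] [Finite (O ⧸ Ideal.span {π})]

section Dwork

variable {A : Type v} [CommRing A] [Algebra O A]

/-- An `O`-algebra endomorphism lifting the `q`-Frobenius modulo `π`. -/
def IsFrobeniusLift (φ : A →ₐ[O] A) : Prop := ∀ a, algebraMap O A π ∣ φ a - a ^ resCard π

lemma pow_dvd_pow_sub_pow {a b : A} {k : ℕ} (hk : k ≠ 0) (h : algebraMap O A π ^ k ∣ a - b) :
    algebraMap O A π ^ (k + 1) ∣ a ^ resCard π - b ^ resCard π := by
  have h1 : algebraMap O A π ∣ a - b := (dvd_pow_self _ hk).trans h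
  rw [← Commute.geom_sum₂_mul (Commute.all a b), pow_succ']
  refine mul_dvd_mul ?_ h
  have h2 : algebraMap O A π ∣ (resCard π : A) * b ^ (resCard π - 1) := by
    refine Dvd.dvd.mul_right ?_ _
    simpa using map_dvd (algebraMap O A) (dvd_resCard π)
  rw [← Ideal.mem_span_singleton] at *
  rw [← Ideal.Quotient.eq_zero_iff_mem] at *
  simp only [map_sub, sub_eq_zero, map_sum, map_mul, map_pow, map_natCast] at *
  rw [h1, ← h2]
  rw [Finset.sum_congr rfl (g := fun _ => (Ideal.Quotient.mk (Ideal.span {algebraMap O A π})) b ^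
    (resCard π - 1))]
  · simp
  · intro i hi
    rw [Finset.mem_range] at hi
    rw [← pow_add]
    congr 1
    omega

lemma pow_dvd_pow_pow_sub {a b : A} (h : algebraMap O A π ∣ a - b) (k : ℕ) :
    algebraMap O A π ^ (k + 1) ∣ a ^ resCard π ^ k - b ^ resCard π ^ k := by
  induction k with
  | zero => simpa using h
  | succ k ih =>
    rw [pow_succ (resCard π), pow_mul, pow_mul]
    exact pow_dvd_pow_sub_pow π (by omega) ih

lemma dvd_ghostN_sub (φ : A →ₐ[O] A) (hφ : IsFrobeniusLift π φ) (x : ℕ → A) (i : ℕ) :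
    algebraMap O A π ^ (i + 1) ∣ φ (ghostN π x i) - ghostN π (fun j => x j ^ resCard π) i := by
  rw [map_ghostN]
  unfold ghostN
  rw [← Finset.sum_sub_distrib]
  refine Finset.dvd_sum fun j hj => ?_
  rw [Finset.mem_range] at hj
  rw [← mul_sub, show i + 1 = j + (i - j + 1) by omega, pow_add]
  exact mul_dvd_mul_left _ (pow_dvd_pow_pow_sub π (hφ _) _)

lemma exists_ghostN (φ : A →ₐ[O] A) (hφ : IsFrobeniusLift π φ) (g : ℕ → A) (n : ℕ)
    (hg : ∀ i < n, algebraMap O A π ^ (i + 1) ∣ φ (g i) - g (i + 1)) :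
    ∃ x : ℕ → A, ∀ i ≤ n, ghostN π x i = g i := by
  induction n with
  | zero => exact ⟨g, fun i hi => by obtain rfl : i = 0 := by omega
                                     simp [ghostN]⟩
  | succ n ih =>
    obtain ⟨x, hx⟩ := ih fun i hi => hg i (by omega)
    obtain ⟨y, hy⟩ := hg n (by omega)
    obtain ⟨z, hz⟩ := dvd_ghostN_sub π φ hφ x n
    have hlt : ∀ (c : A) (i : ℕ), i ≤ n →
        ghostN π (Function.update x (n + 1) c) i = ghostN π x i := by
      intro c i hi
      refine Finset.sum_congr rfl fun j hj => ?_
      rw [Finset.mem_range] at hj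
      rw [Function.update_of_ne (by omega)]
    have hlt' : ∀ (c : A), ghostN π (fun j => Function.update x (n + 1) c j ^ resCard π) n =
        ghostN π (fun j => x j ^ resCard π) n := by
      intro c
      refine Finset.sum_congr rfl fun j hj => ?_
      rw [Finset.mem_range] at hj
      simp only
      rw [Function.update_of_ne (by omega)]
    refine ⟨Function.update x (n + 1) (z - y), fun i hi => ?_⟩
    rcases Nat.lt_or_ge n i with h | h
    · obtain rfl : i = n + 1 := by omega
      rw [ghostN_succ, hlt', Function.update_self, mul_sub, ← hz, ← hy, hx n le_rfl]
      ring
    · rw [hlt _ _ h, hx i h]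

/-- Dwork's criterion. -/
lemma exists_ghost_iff (φ : A →ₐ[O] A) (hφ : IsFrobeniusLift π φ) {n : ℕ} (g : Fin (n + 1) → A) :
    (∃ x : Fin (n + 1) → A, ghost π x = g) ↔
      ∀ i : Fin n, algebraMap O A π ^ ((i : ℕ) + 1) ∣ φ (g i.castSucc) - g i.succ := by
  constructor
  · rintro ⟨x, rfl⟩ i
    obtain ⟨y, rfl⟩ := exists_val_eq x
    rw [ghost_val, ghost_val]
    simp only [Fin.val_castSucc, Fin.val_succ]
    rw [ghostN_succ, ← sub_sub]
    exact dvd_sub (dvd_ghostN_sub π φ hφ _ _) (dvd_mul_right _ _)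
  · intro h
    obtain ⟨g, rfl⟩ := exists_val_eq g
    obtain ⟨x, hx⟩ := exists_ghostN π φ hφ g n fun i hi => h ⟨i, hi⟩
    exact ⟨fun j => x j, by ext i; rw [ghost_val]; exact hx _ (by omega)⟩

/-- The ghost vectors form a subring. -/
lemma ghost_closed (φ : A →ₐ[O] A) (hφ : IsFrobeniusLift π φ) {n : ℕ} (x y : Fin (n + 1) → A) :
    (∃ z, ghost π z = ghost π x + ghost π y) ∧ (∃ z, ghost π z = ghost π x * ghost π y) ∧
      (∃ z, ghost π z = - ghost π x) := by
  have hx := (exists_ghost_iff π φ hφ (ghost π x)).1 ⟨x, rfl⟩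
  have hy := (exists_ghost_iff π φ hφ (ghost π y)).1 ⟨y, rfl⟩
  refine ⟨(exists_ghost_iff π φ hφ _).2 fun i => ?_, (exists_ghost_iff π φ hφ _).2 fun i => ?_,
    (exists_ghost_iff π φ hφ _).2 fun i => ?_⟩
  · convert dvd_add (hx i) (hy i) using 1
    simp only [Pi.add_apply, map_add]
    ring
  · convert dvd_add ((hx i).mul_right (φ (ghost π y i.castSucc)))
      ((hy i).mul_left (ghost π x i.succ)) using 1
    simp only [Pi.mul_apply, map_mul]
    ring
  · convert (dvd_neg (α := A)).2 (hx i) using 1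
    simp only [Pi.neg_apply, map_neg]
    ring

end Dwork

section Universal

variable {σ : Type v}

lemma isFrobeniusLift_of_X (φ : MvPolynomial σ O →ₐ[O] MvPolynomial σ O)
    (h : ∀ s, algebraMap O _ π ∣ φ (MvPolynomial.X s) - MvPolynomial.X s ^ resCard π) :
    IsFrobeniusLift π φ := by
  intro a
  induction a using MvPolynomial.induction_on with
  | C c =>
    rw [← MvPolynomial.algebraMap_eq, AlgHom.commutes, ← map_pow, ← map_sub]
    exact map_dvd _ (dvd_sub_pow_resCard π c)
  | add p r hp hr =>
    convert dvd_add (dvd_add hp hr) (dvd_add_pow_sub π p r) using 1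
    rw [map_add]
    ring
  | mul_X p s hp =>
    convert dvd_add (hp.mul_right (φ (MvPolynomial.X s))) ((h s).mul_left (p ^ resCard π)) using 1
    rw [map_mul, mul_pow]
    ring

/-- The Frobenius lift `X s ↦ X s ^ q` of a polynomial ring. -/
def powLift (σ : Type v) : MvPolynomial σ O →ₐ[O] MvPolynomial σ O :=
  MvPolynomial.aeval fun s => MvPolynomial.X s ^ resCard π

lemma isFrobeniusLift_powLift : IsFrobeniusLift π (powLift π σ) :=
  isFrobeniusLift_of_X π _ fun s => by simp [powLift]

lemma isLeftRegular_MvPolynomial [IsDomain O] :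
    IsLeftRegular (algebraMap O (MvPolynomial σ O) π) := by
  have hπ : Prime π := Fact.out
  refine (IsRegular.of_ne_zero ?_).left
  rw [MvPolynomial.algebraMap_eq]
  simpa using hπ.ne_zero

/-- The structure polynomials of the addition of `Wₙ`. -/
def addPoly (n : ℕ) : Fin (n + 1) → MvPolynomial (Fin (n + 1) ⊕ Fin (n + 1)) O :=
  (ghost_closed π _ (isFrobeniusLift_powLift π)
    (fun i => MvPolynomial.X (Sum.inl i)) (fun i => MvPolynomial.X (Sum.inr i))).1.choose

lemma ghost_addPoly (n : ℕ) : ghost π (addPoly π n) =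
    ghost π (fun i => MvPolynomial.X (Sum.inl i)) + ghost π (fun i => MvPolynomial.X (Sum.inr i)) :=
  (ghost_closed π _ (isFrobeniusLift_powLift π)
    (fun i => MvPolynomial.X (Sum.inl i)) (fun i => MvPolynomial.X (Sum.inr i))).1.choose_spec

/-- The structure polynomials of the multiplication of `Wₙ`. -/
def mulPoly (n : ℕ) : Fin (n + 1) → MvPolynomial (Fin (n + 1) ⊕ Fin (n + 1)) O :=
  (ghost_closed π _ (isFrobeniusLift_powLift π)
    (fun i => MvPolynomial.X (Sum.inl i)) (fun i => MvPolynomial.X (Sum.inr i))).2.1.choose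

lemma ghost_mulPoly (n : ℕ) : ghost π (mulPoly π n) =
    ghost π (fun i => MvPolynomial.X (Sum.inl i)) * ghost π (fun i => MvPolynomial.X (Sum.inr i)) :=
  (ghost_closed π _ (isFrobeniusLift_powLift π)
    (fun i => MvPolynomial.X (Sum.inl i)) (fun i => MvPolynomial.X (Sum.inr i))).2.1.choose_spec

/-- The structure polynomials of the negation of `Wₙ`. -/
def negPoly (n : ℕ) : Fin (n + 1) → MvPolynomial (Fin (n + 1)) O :=
  (ghost_closed π _ (isFrobeniusLift_powLift π) MvPolynomial.X MvPolynomial.X).2.2.choose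

lemma ghost_negPoly (n : ℕ) : ghost π (negPoly π n) = - ghost π MvPolynomial.X :=
  (ghost_closed π _ (isFrobeniusLift_powLift π) MvPolynomial.X MvPolynomial.X).2.2.choose_spec

end Universal

end Ghost

/-! ### The ring of truncated `π`-typical Witt vectors -/

section Witt

variable {O : Type u}

/-- The set `Wₙ(B) = B ^ (n + 1)` of truncated `π`-typical Witt vectors. -/
@[ext]
structure Witt (_π : O) (n : ℕ) (B : Type v) where
  /-- The components `(b₀, …, bₙ)`. -/
  coeff : Fin (n + 1) → B

namespace Witt

variable [CommRing O] {π : O} {n : ℕ} {B : Type v} [CommRing B] [Algebra O B]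

/-- The ghost map `w`. -/
def gh (x : Witt π n B) : Fin (n + 1) → B := ghost π x.coeff

/-- Functoriality of `Wₙ` on underlying sets. -/
def mapFun {B' : Type w} (f : B → B') (x : Witt π n B) : Witt π n B' := ⟨fun i => f (x.coeff i)⟩

lemma gh_injective (hB : IsLeftRegular (algebraMap O B π)) :
    Function.Injective (gh : Witt π n B → _) := fun _ _ h => Witt.ext (ghost_injective π hB h)

variable [Fact (Prime π)] [Finite (O ⧸ Ideal.span {π})]

instance : Zero (Witt π n B) := ⟨⟨fun _ => 0⟩⟩
instance : One (Witt π n B) := ⟨⟨fun i => if i = 0 then 1 else 0⟩⟩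
instance : Add (Witt π n B) :=
  ⟨fun x y => ⟨fun i => MvPolynomial.aeval (Sum.elim x.coeff y.coeff) (addPoly π n i)⟩⟩
instance : Mul (Witt π n B) :=
  ⟨fun x y => ⟨fun i => MvPolynomial.aeval (Sum.elim x.coeff y.coeff) (mulPoly π n i)⟩⟩
instance : Neg (Witt π n B) :=
  ⟨fun x => ⟨fun i => MvPolynomial.aeval x.coeff (negPoly π n i)⟩⟩

lemma gh_zero : gh (0 : Witt π n B) = 0 := by
  have hq := one_lt_resCard π
  ext i
  change ghost π (fun _ => 0) i = 0
  simp [ghost, show resCard π ≠ 0 by omega]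

lemma gh_one : gh (1 : Witt π n B) = 1 := by
  have hq := one_lt_resCard π
  ext i
  change ghost π (fun i => if i = 0 then 1 else 0) i = 1
  rw [ghost, Finset.sum_eq_single 0]
  · simp
  · intro j _ hj
    simp [hj, show resCard π ≠ 0 by omega]
  · simp

lemma gh_add (x y : Witt π n B) : gh (x + y) = gh x + gh y := by
  ext i
  have := congrArg (MvPolynomial.aeval (Sum.elim x.coeff y.coeff)) (congrFun (ghost_addPoly π n) i)
  rw [Pi.add_apply, map_add] at this
  simp only [map_ghost, MvPolynomial.aeval_X, Sum.elim_inl, Sum.elim_inr] at this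
  exact this

lemma gh_mul (x y : Witt π n B) : gh (x * y) = gh x * gh y := by
  ext i
  have := congrArg (MvPolynomial.aeval (Sum.elim x.coeff y.coeff)) (congrFun (ghost_mulPoly π n) i)
  rw [Pi.mul_apply, map_mul] at this
  simp only [map_ghost, MvPolynomial.aeval_X, Sum.elim_inl, Sum.elim_inr] at this
  exact this

lemma gh_neg (x : Witt π n B) : gh (-x) = - gh x := by
  ext i
  have := congrArg (MvPolynomial.aeval x.coeff) (congrFun (ghost_negPoly π n) i)
  rw [Pi.neg_apply, map_neg] at this
  simp only [map_ghost, MvPolynomial.aeval_X] at this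
  exact this

section map
variable {B' : Type w} [CommRing B'] [Algebra O B'] (f : B →ₐ[O] B')

lemma mapFun_zero : mapFun f (0 : Witt π n B) = 0 := by
  ext i
  exact map_zero f

lemma mapFun_one : mapFun f (1 : Witt π n B) = 1 := by
  ext i
  change f (if i = 0 then 1 else 0) = if i = 0 then 1 else 0
  split_ifs <;> simp

lemma mapFun_add (x y : Witt π n B) : mapFun f (x + y) = mapFun f x + mapFun f y := by
  ext i
  change f (MvPolynomial.aeval _ _) = MvPolynomial.aeval _ _
  rw [← AlgHom.comp_apply, MvPolynomial.comp_aeval]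
  congr 2
  ext (j | j) <;> rfl

lemma mapFun_mul (x y : Witt π n B) : mapFun f (x * y) = mapFun f x * mapFun f y := by
  ext i
  change f (MvPolynomial.aeval _ _) = MvPolynomial.aeval _ _
  rw [← AlgHom.comp_apply, MvPolynomial.comp_aeval]
  congr 2
  ext (j | j) <;> rfl

lemma mapFun_neg (x : Witt π n B) : mapFun f (-x) = -mapFun f x := by
  ext i
  change f (MvPolynomial.aeval _ _) = MvPolynomial.aeval _ _
  rw [← AlgHom.comp_apply, MvPolynomial.comp_aeval]
  rfl

end map

lemma mapFun_surjective {B' : Type w} {f : B → B'} (hf : Function.Surjective f) :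
    Function.Surjective (mapFun f : Witt π n B → Witt π n B') := by
  intro x
  choose g hg using hf
  exact ⟨⟨fun i => g (x.coeff i)⟩, by ext i; exact hg _⟩

lemma exists_lift (x : Witt π n B) :
    ∃ y : Witt π n (MvPolynomial B O), mapFun (MvPolynomial.aeval (R := O) (id : B → B)) y = x :=
  mapFun_surjective (fun b => ⟨MvPolynomial.X b, by simp⟩) x

variable [IsDomain O]

lemma add_assoc_aux (x y z : Witt π n B) : x + y + z = x + (y + z) := by
  obtain ⟨x, rfl⟩ := exists_lift x
  obtain ⟨y, rfl⟩ := exists_lift y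
  obtain ⟨z, rfl⟩ := exists_lift z
  simp only [← mapFun_add]
  congr 1
  apply gh_injective (isLeftRegular_MvPolynomial π)
  simp only [gh_add]
  exact add_assoc _ _ _

lemma zero_add_aux (x : Witt π n B) : 0 + x = x := by
  obtain ⟨x, rfl⟩ := exists_lift x
  rw [← mapFun_zero (MvPolynomial.aeval (R := O) (id : B → B)), ← mapFun_add]
  congr 1
  apply gh_injective (isLeftRegular_MvPolynomial π)
  simp only [gh_add, gh_zero]
  exact zero_add _

lemma neg_add_cancel_aux (x : Witt π n B) : -x + x = 0 := by
  obtain ⟨x, rfl⟩ := exists_lift x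
  rw [← mapFun_zero (MvPolynomial.aeval (R := O) (id : B → B)), ← mapFun_neg, ← mapFun_add]
  congr 1
  apply gh_injective (isLeftRegular_MvPolynomial π)
  simp only [gh_add, gh_neg, gh_zero]
  exact neg_add_cancel _

lemma mul_assoc_aux (x y z : Witt π n B) : x * y * z = x * (y * z) := by
  obtain ⟨x, rfl⟩ := exists_lift x
  obtain ⟨y, rfl⟩ := exists_lift y
  obtain ⟨z, rfl⟩ := exists_lift z
  simp only [← mapFun_mul]
  congr 1
  apply gh_injective (isLeftRegular_MvPolynomial π)
  simp only [gh_mul]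
  exact mul_assoc _ _ _

lemma mul_comm_aux (x y : Witt π n B) : x * y = y * x := by
  obtain ⟨x, rfl⟩ := exists_lift x
  obtain ⟨y, rfl⟩ := exists_lift y
  simp only [← mapFun_mul]
  congr 1
  apply gh_injective (isLeftRegular_MvPolynomial π)
  simp only [gh_mul]
  exact mul_comm _ _

lemma one_mul_aux (x : Witt π n B) : 1 * x = x := by
  obtain ⟨x, rfl⟩ := exists_lift x
  rw [← mapFun_one (MvPolynomial.aeval (R := O) (id : B → B)), ← mapFun_mul]
  congr 1
  apply gh_injective (isLeftRegular_MvPolynomial π)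
  simp only [gh_mul, gh_one]
  exact one_mul _

lemma left_distrib_aux (x y z : Witt π n B) : x * (y + z) = x * y + x * z := by
  obtain ⟨x, rfl⟩ := exists_lift x
  obtain ⟨y, rfl⟩ := exists_lift y
  obtain ⟨z, rfl⟩ := exists_lift z
  simp only [← mapFun_mul, ← mapFun_add]
  congr 1
  apply gh_injective (isLeftRegular_MvPolynomial π)
  simp only [gh_mul, gh_add]
  exact mul_add _ _ _

instance : CommRing (Witt π n B) :=
  CommRing.ofMinimalAxioms add_assoc_aux zero_add_aux neg_add_cancel_aux mul_assoc_aux mul_comm_aux one_mul_aux left_distrib_aux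

/-- The ring homomorphism `Wₙ(f) : Wₙ(B) → Wₙ(B')`, applying `f` to every component. -/
def map {B' : Type w} [CommRing B'] [Algebra O B'] (f : B →ₐ[O] B') :
    Witt π n B →+* Witt π n B' where
  toFun := mapFun f
  map_zero' := mapFun_zero f
  map_one' := mapFun_one f
  map_add' := mapFun_add f
  map_mul' := mapFun_mul f

/-- The projection `Wₙ(B) → B`, `(b₀, …, bₙ) ↦ b₀`. -/
def proj : Witt π n B →+* B where
  toFun x := x.coeff 0
  map_zero' := rfl
  map_one' := rfl
  map_add' x y := by
    have := congrFun (gh_add x y) 0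
    simpa [gh, ghost, show Finset.Iic (0 : Fin (n + 1)) = {0} from rfl] using this
  map_mul' x y := by
    have := congrFun (gh_mul x y) 0
    simpa [gh, ghost, show Finset.Iic (0 : Fin (n + 1)) = {0} from rfl] using this

end Witt

end Witt

/-! ### The canonical map `exp : C₀ → Wₙ(Cₙ)` of a prolongation sequence -/

section Exp

variable {O : Type u} [CommRing O] [IsDomain O] (π : O) [Fact (Prime π)]
  [Finite (O ⧸ Ideal.span {π})]

/-- The endomorphism `T⁽ⁱ⁾ ↦ (T⁽ⁱ⁾) ^ q + π T⁽ⁱ⁺¹⁾` of the polynomial ring over `O` in the jet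
variables of a family of indeterminates. -/
def jetLift (σ : Type v) : MvPolynomial (σ × ℕ) O →ₐ[O] MvPolynomial (σ × ℕ) O :=
  MvPolynomial.aeval fun s => MvPolynomial.X s ^ resCard π
    + algebraMap O _ π * MvPolynomial.X (s.1, s.2 + 1)

lemma isFrobeniusLift_jetLift (σ : Type v) : IsFrobeniusLift π (jetLift π σ) :=
  isFrobeniusLift_of_X π _ fun s => by simp [jetLift]

lemma exists_ghost_iterate {σ : Type v} (n : ℕ) (t : MvPolynomial (σ × ℕ) O) :
    ∃ x : Fin (n + 1) → MvPolynomial (σ × ℕ) O,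
      ghost π x = fun i : Fin (n + 1) => (jetLift π σ)^[(i : ℕ)] t :=
  (exists_ghost_iff π _ (isFrobeniusLift_jetLift π σ) _).2 fun i => by
    simp only [Fin.val_castSucc, Fin.val_succ]
    rw [Function.iterate_succ_apply', sub_self]
    exact dvd_zero _

/-- The polynomials `P₀, …, Pₙ ∈ O[T, T′, T″, …]`, determined by
`∑_{j ≤ i} π ^ j * P_j ^ (q ^ (i - j)) = φ ^ i (T)`, where `φ (T⁽ⁱ⁾) = (T⁽ⁱ⁾) ^ q + π T⁽ⁱ⁺¹⁾`. -/
def expPoly (n : ℕ) : Fin (n + 1) → MvPolynomial (Unit × ℕ) O :=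
  (exists_ghost_iterate π n (MvPolynomial.X ((), 0))).choose

lemma ghost_expPoly (n : ℕ) :
    ghost π (expPoly π n) = fun i : Fin (n + 1) => (jetLift π Unit)^[(i : ℕ)] (MvPolynomial.X ((), 0)) :=
  (exists_ghost_iterate π n (MvPolynomial.X ((), 0))).choose_spec

lemma aeval_iterate_congr {B : Type v} [CommRing B] [Algebra O B] {v v' : Unit × ℕ → B} (m : ℕ)
    (h : ∀ j ≤ m, v ((), j) = v' ((), j)) (i j : ℕ) (hij : j + i ≤ m) :
    MvPolynomial.aeval v ((jetLift π Unit)^[i] (MvPolynomial.X ((), j)))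
      = MvPolynomial.aeval v' ((jetLift π Unit)^[i] (MvPolynomial.X ((), j))) := by
  induction i generalizing j with
  | zero => simpa using h j (by omega)
  | succ i ih =>
    have : jetLift π Unit (MvPolynomial.X ((), j)) = MvPolynomial.X ((), j) ^ resCard π
      + algebraMap O _ π * MvPolynomial.X ((), j + 1) := by simp [jetLift]
    rw [Function.iterate_succ_apply, this]
    simp only [← AlgHom.coe_pow, map_add, map_mul, map_pow, AlgHom.commutes] at ih ⊢
    rw [ih j (by omega), ih (j + 1) (by omega)]

/-- `Pᵢ` for `i ≤ n` only involves the variables `T⁽ʲ⁾` with `j ≤ n`. -/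
lemma aeval_expPoly_congr {B : Type v} [CommRing B] [Algebra O B] {v v' : Unit × ℕ → B} (n : ℕ)
    (h : ∀ j ≤ n, v ((), j) = v' ((), j)) (i : Fin (n + 1)) :
    MvPolynomial.aeval v (expPoly π n i) = MvPolynomial.aeval v' (expPoly π n i) := by
  let w : Unit × ℕ → MvPolynomial (Unit × ℕ) O :=
    fun s => if s.2 ≤ n then MvPolynomial.X s else 0
  have key : (fun i => MvPolynomial.aeval w (expPoly π n i)) = expPoly π n := by
    apply ghost_injective π (isLeftRegular_MvPolynomial π)
    ext1 i
    rw [← map_ghost, ghost_expPoly]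
    dsimp only
    rw [aeval_iterate_congr π n (v' := MvPolynomial.X) (fun j hj => by simp [w, hj]) i 0
      (by omega)]
    simp
  have key' : ∀ v : Unit × ℕ → B, MvPolynomial.aeval v (expPoly π n i) =
      MvPolynomial.aeval (fun s => if s.2 ≤ n then v s else 0) (expPoly π n i) := by
    intro v
    conv_lhs => rw [← congrFun key i]
    rw [← AlgHom.comp_apply, MvPolynomial.comp_aeval]
    congr 2
    ext s
    simp only [w]
    split_ifs <;> simp
  rw [key' v, key' v']
  congr 2
  ext ⟨_, j⟩
  dsimp only
  split_ifs with hj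
  · exact h j hj
  · rfl

namespace ProlongationSequence

variable {π} (C : ProlongationSequence.{u, v} π)

/-- `C.jet n c j` is the image in `Cₙ` of `δ ^ j (c) = δ_{j-1} (⋯ (δ₀ c)) ∈ C_j` for `j ≤ n`
(and is `0` for `j > n`). -/
def jet : ∀ n, C.obj 0 → ℕ → C.obj n
  | 0, c, j => if j = 0 then c else 0
  | n + 1, c, j =>
    if j ≤ n then C.u n (jet n c j) else if j = n + 1 then C.δ n (jet n c n) else 0

lemma jet_succ {n : ℕ} {c : C.obj 0} {j : ℕ} (hj : j ≤ n) :
    C.jet (n + 1) c (j + 1) = C.δ n (C.jet n c j) := by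
  induction n with
  | zero =>
    obtain rfl : j = 0 := by omega
    simp [jet]
  | succ m ih =>
    rcases hj.lt_or_eq with h | rfl
    · rw [jet, if_pos (by omega), ih (by omega), C.u_δ, jet, if_pos (by omega)]
    · rw [jet, if_neg (by omega), if_pos rfl]

/-- The composite `C₀ → C₁ → ⋯ → Cₙ` of the maps `u`. -/
def unit : ∀ n, C.obj 0 →ₐ[O] C.obj n
  | 0 => AlgHom.id O _
  | n + 1 => (C.u n).comp (unit n)

/-- The map `c ↦ (P₀(c), …, Pₙ(c))`, where `Pᵢ(c) = Pᵢ(c, δ c, …, δ ^ i c)`. -/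
def expFun (n : ℕ) (c : C.obj 0) : Witt π n (C.obj n) :=
  ⟨fun i => MvPolynomial.aeval (fun s => C.jet n c s.2) (expPoly π n i)⟩

section

variable {σ : Type}

/-- The `π`-derivation of the polynomial ring. -/
def polyDelta (t : MvPolynomial (σ × ℕ) O) : MvPolynomial (σ × ℕ) O :=
  (isFrobeniusLift_jetLift π σ t).choose

lemma polyDelta_spec (t : MvPolynomial (σ × ℕ) O) :
    jetLift π σ t - t ^ resCard π = algebraMap O _ π * polyDelta (π := π) t :=
  (isFrobeniusLift_jetLift π σ t).choose_spec

lemma polyDelta_eq {t s : MvPolynomial (σ × ℕ) O} (h : jetLift π σ t - t ^ resCard π = algebraMap O _ π * s) :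
    polyDelta (π := π) t = s :=
  isLeftRegular_MvPolynomial π (by simpa only [← polyDelta_spec] using h)

lemma polyDelta_X (s : σ × ℕ) : polyDelta (π := π) (MvPolynomial.X s : MvPolynomial (σ × ℕ) O)
    = MvPolynomial.X (s.1, s.2 + 1) :=
  polyDelta_eq (by simp [jetLift])

lemma polyDelta_algebraMap (c : O) : polyDelta (π := π) (algebraMap O (MvPolynomial (σ × ℕ) O) c)
    = algebraMap O (MvPolynomial (σ × ℕ) O) (delta π c) :=
  polyDelta_eq (by rw [AlgHom.commutes, ← map_pow, ← map_sub, delta_spec, map_mul])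

lemma polyDelta_add (x y : MvPolynomial (σ × ℕ) O) : polyDelta (π := π) (x + y)
    = polyDelta (π := π) x + polyDelta (π := π) y + MvPolynomial.aeval ![x, y] (cPoly π) :=
  polyDelta_eq (by
    rw [mul_add, mul_add, ← polyDelta_spec, ← polyDelta_spec, ← aeval_cPoly_spec, map_add]
    ring)

lemma polyDelta_mul (x y : MvPolynomial (σ × ℕ) O) : polyDelta (π := π) (x * y)
    = x ^ resCard π * polyDelta (π := π) y + y ^ resCard π * polyDelta (π := π) x
      + algebraMap O _ π * polyDelta (π := π) x * polyDelta (π := π) y :=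
  polyDelta_eq (by
    have hx := sub_eq_iff_eq_add.1 (polyDelta_spec (π := π) x)
    have hy := sub_eq_iff_eq_add.1 (polyDelta_spec (π := π) y)
    rw [map_mul, hx, hy]
    ring)

/-- The polynomials in the jet variables of order at most `k`. -/
def jetSub (O : Type u) [CommRing O] (σ : Type v) (k : ℕ) : Subalgebra O (MvPolynomial (σ × ℕ) O) :=
  Algebra.adjoin O {t | ∃ s : σ, ∃ j ≤ k, t = MvPolynomial.X (s, j)}

lemma jetSub_mono {k l : ℕ} (h : k ≤ l) : jetSub O σ k ≤ jetSub O σ l := by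
  apply Algebra.adjoin_mono
  rintro t ⟨s, j, hj, rfl⟩
  exact ⟨s, j, hj.trans h, rfl⟩

lemma polyDelta_mem {k : ℕ} {t : MvPolynomial (σ × ℕ) O} (ht : t ∈ jetSub O σ k) :
    polyDelta (π := π) t ∈ jetSub O σ (k + 1) := by
  induction ht using Algebra.adjoin_induction with
  | mem t ht =>
    obtain ⟨s, j, hj, rfl⟩ := ht
    rw [polyDelta_X]
    exact Algebra.subset_adjoin ⟨s, j + 1, by omega, rfl⟩
  | algebraMap c =>
    rw [polyDelta_algebraMap]
    exact Subalgebra.algebraMap_mem _ _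
  | add x y hx hy ihx ihy =>
    rw [polyDelta_add]
    refine add_mem (add_mem ihx ihy) ?_
    have hx' : x ∈ jetSub O σ (k + 1) := jetSub_mono (by omega) hx
    have hy' : y ∈ jetSub O σ (k + 1) := jetSub_mono (by omega) hy
    have : MvPolynomial.aeval ![x, y] (cPoly π) = (jetSub O σ (k + 1)).val
        (MvPolynomial.aeval ![⟨x, hx'⟩, ⟨y, hy'⟩] (cPoly π)) := by
      rw [← AlgHom.comp_apply, MvPolynomial.comp_aeval]
      congr 2
      ext i
      fin_cases i <;> rfl
    rw [this]
    exact Subtype.property _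
  | mul x y hx hy ihx ihy =>
    rw [polyDelta_mul]
    have hx' : x ∈ jetSub O σ (k + 1) := jetSub_mono (by omega) hx
    have hy' : y ∈ jetSub O σ (k + 1) := jetSub_mono (by omega) hy
    exact add_mem (add_mem (mul_mem (pow_mem hx' _) ihy) (mul_mem (pow_mem hy' _) ihx))
      (mul_mem (mul_mem (Subalgebra.algebraMap_mem _ _) ihx) ihy)

lemma iterate_polyDelta_mem {t : MvPolynomial (σ × ℕ) O} (ht : t ∈ jetSub O σ 0) (k : ℕ) :
    (polyDelta (π := π))^[k] t ∈ jetSub O σ k := by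
  induction k with
  | zero => exact ht
  | succ k ih =>
    rw [Function.iterate_succ_apply']
    exact polyDelta_mem ih

variable (c : σ → C.obj 0)

/-- The evaluation of polynomials at the jets of a family of elements. -/
def evalJet (n : ℕ) : MvPolynomial (σ × ℕ) O →ₐ[O] C.obj n := MvPolynomial.aeval fun s => C.jet n (c s.1) s.2

lemma evalJet_succ {n : ℕ} {t : MvPolynomial (σ × ℕ) O} (ht : t ∈ jetSub O σ n) :
    C.evalJet c (n + 1) t = C.u n (C.evalJet c n t) ∧
      C.evalJet c (n + 1) (polyDelta (π := π) t) = C.δ n (C.evalJet c n t) := by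
  induction ht using Algebra.adjoin_induction with
  | mem t ht =>
    obtain ⟨s, j, hj, rfl⟩ := ht
    refine ⟨by simp [evalJet, jet, hj], ?_⟩
    rw [polyDelta_X]
    simp [evalJet, C.jet_succ hj]
  | algebraMap r =>
    rw [polyDelta_algebraMap]
    simp only [AlgHom.commutes, C.δ_algebraMap, and_self]
  | add x y hx hy ihx ihy =>
    rw [polyDelta_add]
    simp only [map_add, ihx.1, ihy.1, ihx.2, ihy.2, (C.isPiDerivation n).map_add, true_and]
    congr 1
    rw [← AlgHom.comp_apply, MvPolynomial.comp_aeval]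
    congr 2
    ext i
    fin_cases i
    · exact ihx.1
    · exact ihy.1
  | mul x y hx hy ihx ihy =>
    rw [polyDelta_mul]
    simp only [map_add, map_mul, map_pow, ihx.1, ihy.1, ihx.2, ihy.2,
      (C.isPiDerivation n).map_mul, AlgHom.commutes, true_and]

lemma evalJet_iterate {t : MvPolynomial (σ × ℕ) O} (ht : t ∈ jetSub O σ 0) {n j : ℕ}
    (hj : j ≤ n) :
    C.evalJet c n ((polyDelta (π := π))^[j] t) = C.jet n (C.evalJet c 0 t) j := by
  induction n generalizing j with
  | zero =>
    obtain rfl : j = 0 := by omega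
    simp [jet]
  | succ n ih =>
    rcases hj.lt_or_eq with h | rfl
    · have hmem := jetSub_mono (show j ≤ n by omega) (iterate_polyDelta_mem (π := π) ht j)
      rw [(C.evalJet_succ c hmem).1, ih (by omega), jet, if_pos (by omega)]
    · rw [Function.iterate_succ_apply', (C.evalJet_succ c (iterate_polyDelta_mem ht n)).2,
        ih le_rfl, jet, if_neg (by omega), if_pos rfl]

/-- The canonical section `t ↦ (P₀(t), …, Pₙ(t))` for the polynomial ring. -/
def polyExp (n : ℕ) (t : MvPolynomial (σ × ℕ) O) : Witt π n (MvPolynomial (σ × ℕ) O) :=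
  ⟨fun i => MvPolynomial.aeval (fun s => (polyDelta (π := π))^[s.2] t) (expPoly π n i)⟩

lemma gh_polyExp (n : ℕ) (t : MvPolynomial (σ × ℕ) O) (i : Fin (n + 1)) :
    (polyExp (π := π) n t).gh i = (jetLift π σ)^[(i : ℕ)] t := by
  let f : MvPolynomial (Unit × ℕ) O →ₐ[O] MvPolynomial (σ × ℕ) O :=
    MvPolynomial.aeval fun s => (polyDelta (π := π))^[s.2] t
  have hf : f.comp (jetLift π Unit) = (jetLift π σ).comp f := by
    ext1 s
    have := sub_eq_iff_eq_add.1 (polyDelta_spec (π := π) ((polyDelta (π := π))^[s.2] t))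
    simp [f, jetLift, Function.iterate_succ_apply'] at this ⊢
    rw [this, add_comm]
  change ghost π (fun i => f (expPoly π n i)) i = _
  rw [← map_ghost, ghost_expPoly]
  have : ∀ k (x : MvPolynomial (Unit × ℕ) O),
      f ((jetLift π Unit)^[k] x) = (jetLift π σ)^[k] (f x) := fun k x =>
    Function.Semiconj.iterate_right (f := f) (fun x => DFunLike.congr_fun hf x) k x
  rw [this]
  simp [f]

lemma map_polyExp {t : MvPolynomial (σ × ℕ) O} (ht : t ∈ jetSub O σ 0) (n : ℕ) :
    Witt.map (C.evalJet c n) (polyExp n t) = C.expFun n (C.evalJet c 0 t) := by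
  ext i
  change C.evalJet c n (MvPolynomial.aeval _ (expPoly π n i)) = MvPolynomial.aeval _ _
  rw [← AlgHom.comp_apply, MvPolynomial.comp_aeval]
  exact aeval_expPoly_congr π n (fun j hj => C.evalJet_iterate c ht hj) i

lemma polyExp_add (n : ℕ) (x y : MvPolynomial (σ × ℕ) O) :
    polyExp (π := π) n (x + y) = polyExp n x + polyExp n y := by
  apply Witt.gh_injective (isLeftRegular_MvPolynomial π)
  ext1 i
  rw [Witt.gh_add, Pi.add_apply, gh_polyExp, gh_polyExp, gh_polyExp, iterate_map_add]

lemma polyExp_mul (n : ℕ) (x y : MvPolynomial (σ × ℕ) O) :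
    polyExp (π := π) n (x * y) = polyExp n x * polyExp n y := by
  apply Witt.gh_injective (isLeftRegular_MvPolynomial π)
  ext1 i
  rw [Witt.gh_mul, Pi.mul_apply, gh_polyExp, gh_polyExp, gh_polyExp, iterate_map_mul]

lemma polyExp_zero (n : ℕ) : polyExp (π := π) n (0 : MvPolynomial (σ × ℕ) O) = 0 := by
  apply Witt.gh_injective (isLeftRegular_MvPolynomial π)
  ext1 i
  rw [Witt.gh_zero, Pi.zero_apply, gh_polyExp, iterate_map_zero]

lemma polyExp_one (n : ℕ) : polyExp (π := π) n (1 : MvPolynomial (σ × ℕ) O) = 1 := by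
  apply Witt.gh_injective (isLeftRegular_MvPolynomial π)
  ext1 i
  rw [Witt.gh_one, Pi.one_apply, gh_polyExp, iterate_map_one]

end

/-- The canonical ring homomorphism `C₀ → Wₙ(Cₙ)`, `c ↦ (P₀(c), …, Pₙ(c))`. -/
def exp (n : ℕ) : C.obj 0 →+* Witt π n (C.obj n) where
  toFun := C.expFun n
  map_zero' := by
    have h := C.map_polyExp (fun _ : Unit => 0) (zero_mem (jetSub O Unit 0)) n
    rwa [polyExp_zero, map_zero, map_zero, eq_comm] at h
  map_one' := by
    have h := C.map_polyExp (fun _ : Unit => 0) (one_mem (jetSub O Unit 0)) n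
    rwa [polyExp_one, map_one, map_one, eq_comm] at h
  map_add' a b := by
    let c : Bool → C.obj 0 := fun s => cond s a b
    have hX : ∀ s : Bool, MvPolynomial.X (s, 0) ∈ jetSub O Bool 0 := fun s =>
      Algebra.subset_adjoin ⟨s, 0, le_rfl, rfl⟩
    have hc : ∀ s, C.evalJet c 0 (MvPolynomial.X (s, 0)) = c s := fun s => by simp [evalJet, jet]
    have h := C.map_polyExp c (add_mem (hX true) (hX false)) n
    rw [polyExp_add, map_add, C.map_polyExp c (hX true), C.map_polyExp c (hX false), map_add,
      hc, hc] at h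
    exact h.symm
  map_mul' a b := by
    let c : Bool → C.obj 0 := fun s => cond s a b
    have hX : ∀ s : Bool, MvPolynomial.X (s, 0) ∈ jetSub O Bool 0 := fun s =>
      Algebra.subset_adjoin ⟨s, 0, le_rfl, rfl⟩
    have hc : ∀ s, C.evalJet c 0 (MvPolynomial.X (s, 0)) = c s := fun s => by simp [evalJet, jet]
    have h := C.map_polyExp c (mul_mem (hX true) (hX false)) n
    rw [polyExp_mul, map_mul, C.map_polyExp c (hX true), C.map_polyExp c (hX false), map_mul,
      hc, hc] at h
    exact h.symm

lemma jet_zero (n : ℕ) (c : C.obj 0) : C.jet n c 0 = C.unit n c := by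
  induction n with
  | zero => simp [jet, unit]
  | succ n ih => simp [jet, unit, ih]

lemma proj_exp (n : ℕ) (c : C.obj 0) : (C.exp n c).proj = C.unit n c := by
  have h : expPoly π n 0 = MvPolynomial.X ((), 0) := by
    have := congrFun (ghost_expPoly π n) 0
    simpa [ghost, show Finset.Iic (0 : Fin (n + 1)) = {0} from rfl] using this
  change MvPolynomial.aeval _ (expPoly π n 0) = _
  rw [h, MvPolynomial.aeval_X, jet_zero]

end ProlongationSequence

end Exp

/-! ### Sheaves on affine schemes -/

section Sheaves

/-- The category `Aff_R` of affine schemes over `Spec R`, as the opposite category of the category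
of commutative `R`-algebras. -/
abbrev Aff (R : Type v) [CommRing R] : Type (v + 1) := (CommAlgCat.{v} R)ᵒᵖ

/-- The étale topology on `Aff_R`: it is generated by the jointly surjective families of étale
morphisms. -/
def affEtaleTopology (R : Type v) [CommRing R] : GrothendieckTopology (Aff R) :=
  (AlgebraicGeometry.Scheme.etalePrecoverage.{v}.comap
    ((forget₂ (CommAlgCat.{v} R) CommRingCat.{v}).op ⋙
      AlgebraicGeometry.Scheme.Spec)).toGrothendieck

/-- Presheaves of sets on `Aff_R`, i.e. covariant functors on commutative `R`-algebras. -/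
abbrev PreSp (R : Type v) [CommRing R] := (Aff R)ᵒᵖ ⥤ Type w

/-- The category of sheaves of sets on `Aff_R` for the étale topology. -/
abbrev Sp (R : Type v) [CommRing R] := Sheaf (affEtaleTopology R) (Type w)

variable {R : Type v} [CommRing R]

/-- The value `X(B)` of a presheaf on an `R`-algebra `B`. -/
abbrev PreSp.val (X : PreSp.{w} R) (B : CommAlgCat.{v} R) : Type w := X.obj (op (op B))

/-- The map `X(B) → X(B')` induced by an `R`-algebra homomorphism `B → B'`. -/
abbrev PreSp.res (X : PreSp.{w} R) {B B' : CommAlgCat.{v} R} (g : B ⟶ B') : X.val B ⟶ X.val B' :=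
  X.map g.op.op

/-- A map `f : X → Y` is formally étale if for every nilpotent closed immersion
`Spec B' → Spec B` of affine `R`-schemes, the map `X(B) → X(B') ×_{Y(B')} Y(B)` is bijective. -/
def IsFormallyEtale {X Y : PreSp.{w} R} (f : X ⟶ Y) : Prop :=
  ∀ ⦃B B' : CommAlgCat.{v} R⦄ (g : B ⟶ B'), Function.Surjective g.hom →
    IsNilpotent (RingHom.ker g.hom) →
    ∀ (x' : X.val B') (y : Y.val B), f.app (op (op B')) x' = Y.res g y →
      ∃! x : X.val B, X.res g x = x' ∧ f.app (op (op B)) x = y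

/-- Restriction of scalars of algebras along a ring homomorphism. -/
def restrictScalars {R R' : Type v} [CommRing R] [CommRing R'] (φ : R →+* R') :
    CommAlgCat.{v} R' ⥤ CommAlgCat.{v} R where
  obj B :=
    letI : Algebra R B := Algebra.compHom B φ
    CommAlgCat.of R B
  map {B B'} g :=
    letI : Algebra R B := Algebra.compHom B φ
    letI : Algebra R B' := Algebra.compHom B' φ
    CommAlgCat.ofHom { g.hom.toRingHom with commutes' := fun r => g.hom.commutes (φ r) }

/-- The pullback functor `X ↦ Spec R' ×_{Spec R} X` along `Spec R' → Spec R`, which restricts a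
presheaf to the affine `R'`-schemes. -/
def baseChange {R R' : Type v} [CommRing R] [CommRing R'] (φ : R →+* R') :
    PreSp.{w} R ⥤ PreSp.{w} R' :=
  (Functor.whiskeringLeft _ _ _).obj (restrictScalars φ).op.op

end Sheaves

/-! ### Jet spaces -/

section Jet

variable {O : Type u} [CommRing O] [IsDomain O] {π : O} [Fact (Prime π)]
  [Finite (O ⧸ Ideal.span {π})] (C : ProlongationSequence.{u, v} π) (n : ℕ)

namespace ProlongationSequence

/-- The structure of `O`-algebra of a `Cₙ`-algebra. -/
abbrev algebraBase (B : Type v) [CommRing B] [Algebra (C.obj n) B] : Algebra O B :=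
  Algebra.compHom B (algebraMap O (C.obj n))

/-- The structure map of a `Cₙ`-algebra, as a homomorphism of `O`-algebras. -/
def structHom (B : Type v) [CommRing B] [Algebra (C.obj n) B] :
    letI := C.algebraBase n B
    C.obj n →ₐ[O] B :=
  letI := C.algebraBase n B
  { algebraMap (C.obj n) B with commutes' := fun _ => rfl }

/-- A homomorphism of `Cₙ`-algebras, as a homomorphism of `O`-algebras. -/
def homBase {B B' : Type v} [CommRing B] [Algebra (C.obj n) B] [CommRing B'] [Algebra (C.obj n) B']
    (g : B →ₐ[C.obj n] B') :
    letI := C.algebraBase n B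
    letI := C.algebraBase n B'
    B →ₐ[O] B' :=
  letI := C.algebraBase n B
  letI := C.algebraBase n B'
  { g.toRingHom with commutes' := fun r => g.commutes (algebraMap O (C.obj n) r) }

/-- The `C₀`-algebra `Wₙ(B)` of a `Cₙ`-algebra `B`, with structure map the composite
`C₀ → Wₙ(Cₙ) → Wₙ(B)`. -/
def wittObj (B : CommAlgCat.{v} (C.obj n)) : CommAlgCat.{v} (C.obj 0) :=
  letI := C.algebraBase n B
  letI : Algebra (C.obj 0) (Witt π n B) := ((Witt.map (C.structHom n B)).comp (C.exp n)).toAlgebra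
  CommAlgCat.of (C.obj 0) (Witt π n B)

/-- The functor `B ↦ Wₙ(B)` from `Cₙ`-algebras to `C₀`-algebras. -/
def witt : CommAlgCat.{v} (C.obj n) ⥤ CommAlgCat.{v} (C.obj 0) where
  obj := C.wittObj n
  map {B B'} g :=
    letI := C.algebraBase n B
    letI := C.algebraBase n B'
    letI : Algebra (C.obj 0) (Witt π n B) :=
      ((Witt.map (C.structHom n B)).comp (C.exp n)).toAlgebra
    letI : Algebra (C.obj 0) (Witt π n B') :=
      ((Witt.map (C.structHom n B')).comp (C.exp n)).toAlgebra
    CommAlgCat.ofHom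
      { Witt.map (n := n) (C.homBase n g.hom) with
        commutes' := fun r => Witt.ext (funext fun i => g.hom.commutes ((C.exp n r).coeff i)) }

/-- The projection `Wₙ(B) → B`, as a natural homomorphism of `C₀`-algebras. -/
def wittProj : C.witt n ⟶ restrictScalars (C.unit n).toRingHom where
  app B :=
    letI := C.algebraBase n B
    letI : Algebra (C.obj 0) (Witt π n B) :=
      ((Witt.map (C.structHom n B)).comp (C.exp n)).toAlgebra
    letI : Algebra (C.obj 0) B := Algebra.compHom B (C.unit n).toRingHom
    CommAlgCat.ofHom
      { Witt.proj (π := π) (n := n) (B := B) with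
        commutes' := fun r => congrArg (algebraMap (C.obj n) B) (C.proj_exp n r) }
  naturality _ _ _ := rfl

/-- The jet space functor `X ↦ Jⁿ X`, where `Jⁿ X (B) = X(Wₙ(B))`. -/
def jetSpace : PreSp.{w} (C.obj 0) ⥤ PreSp.{w} (C.obj n) :=
  (Functor.whiskeringLeft _ _ _).obj (C.witt n).op.op

/-- The functor `X ↦ X⁽ⁿ⁾ = S⁽ⁿ⁾ ×_{S⁽⁰⁾} X`. -/
abbrev pull : PreSp.{w} (C.obj 0) ⥤ PreSp.{w} (C.obj n) := baseChange (C.unit n).toRingHom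

/-- The natural map `Jⁿ X → X⁽ⁿ⁾`, given by the maps `X(Wₙ(B)) → X(B)` induced by the projections
`Wₙ(B) → B`. -/
def jetProj : jetSpace.{w} C n ⟶ pull.{w} C n :=
  (Functor.whiskeringLeft _ _ _).map (NatTrans.op (NatTrans.op (C.wittProj n)))

/-- The natural map `Jⁿ X → Jⁿ Y ×_{Y⁽ⁿ⁾} X⁽ⁿ⁾`. -/
def jetComparison {X Y : PreSp.{w} (C.obj 0)} (f : X ⟶ Y) :
    (C.jetSpace n).obj X ⟶ pullback ((C.jetProj n).app Y) ((C.pull n).map f) :=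
  pullback.lift ((C.jetSpace n).map f) ((C.jetProj n).app X) ((C.jetProj n).naturality f)

/-- The ring `Cₙ / π ^ m Cₙ`. -/
abbrev modPow (m : ℕ) : Type v := C.obj n ⧸ Ideal.span {algebraMap O (C.obj n) π ^ m}

/-- The functor `X ↦ S⁽ⁿ⁾_m ×_{S⁽ⁿ⁾} X`, where `S⁽ⁿ⁾_m = Spec (Cₙ / π ^ m Cₙ)`. -/
abbrev reduceMod (m : ℕ) : PreSp.{w} (C.obj n) ⥤ PreSp.{w} (C.modPow n m) :=
  baseChange (Ideal.Quotient.mk _)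

end ProlongationSequence

end Jet

end PiJet

end

/-! By definition `Jⁿ X (B) = X(Wₙ(B))`, and the map to `X⁽ⁿ⁾(B) = X(B)` is induced by the
surjection `Wₙ(B) → B`. If the kernel `K` of this surjection is nilpotent, then `Spec B → Spec
Wₙ(B)` is a nilpotent closed immersion of affine `R₀`-schemes, and formal étaleness of `f` on it is
exactly the bijectivity claimed. Everything therefore rests on `Witt.isNilpotent_ker_proj`: `K` is
nilpotent as soon as `π ^ m = 0` in `B`.

Suppose first that `π = 0` in `B`. If the components of `y` before the `i`-th vanish, then `(x *
y)_i = wᵢ(x) y_i` (`mul_coeff_of_forall_lt`). For `x` in `K` every ghost component is zero, because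
`x₀ = 0` and the later summands carry a factor `π`. So multiplication by `K` lengthens the initial
run of zeros by one, and `K ^ (n + 1) = 0`.

In general put `I = πB`. Reduction modulo `I` gives `K ^ (n + 1) ⊆ Wₙ(I)`. Since `Wₙ(I) Wₙ(J) ⊆
Wₙ(IJ)` (`idealOf_mul_le`), the `m`-th power of the left side lies in `Wₙ(I ^ m) = 0`. -/

namespace PiJet

/-! ### Differences of polynomial values modulo ideals -/

section Polynomial

variable {O : Type u} [CommRing O] {σ τ : Type*} {B : Type v} [CommRing B] [Algebra O B]

lemma aeval_sumElim_sub_mem_right {J : Ideal B} (x : σ → B) {y : τ → B} (hy : ∀ t, y t ∈ J)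
    (p : MvPolynomial (σ ⊕ τ) O) :
    MvPolynomial.aeval (Sum.elim x y) p - MvPolynomial.aeval (Sum.elim x 0) p ∈ J := by
  induction p using MvPolynomial.induction_on with
  | C c => simp
  | add p r hp hr =>
    convert add_mem hp hr using 1
    simp only [map_add]
    ring
  | mul_X p s hp =>
    obtain s | t := s
    · convert J.mul_mem_right (x s) hp using 1
      simp only [map_mul, MvPolynomial.aeval_X, Sum.elim_inl]
      ring
    · simpa using J.mul_mem_left _ (hy t)

lemma aeval_sumElim_sub_mem_left {I : Ideal B} {x : σ → B} (hx : ∀ s, x s ∈ I) (y : τ → B)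
    (p : MvPolynomial (σ ⊕ τ) O) :
    MvPolynomial.aeval (Sum.elim x y) p - MvPolynomial.aeval (Sum.elim 0 y) p ∈ I := by
  induction p using MvPolynomial.induction_on with
  | C c => simp
  | add p r hp hr =>
    convert add_mem hp hr using 1
    simp only [map_add]
    ring
  | mul_X p s hp =>
    obtain s | t := s
    · simpa using I.mul_mem_left _ (hx s)
    · convert I.mul_mem_right (y t) hp using 1
      simp only [map_mul, MvPolynomial.aeval_X, Sum.elim_inr]
      ring

/-- The mixed second difference cancels every monomial that does not involve both families of
variables; each remaining one contains a factor from `I` and a factor from `J`. -/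
lemma aeval_sumElim_mixed_mem {I J : Ideal B} {x : σ → B} {y : τ → B} (hx : ∀ s, x s ∈ I)
    (hy : ∀ t, y t ∈ J) (p : MvPolynomial (σ ⊕ τ) O) :
    MvPolynomial.aeval (Sum.elim x y) p - MvPolynomial.aeval (Sum.elim x 0) p
      - MvPolynomial.aeval (Sum.elim 0 y) p + MvPolynomial.aeval (Sum.elim 0 0) p ∈ I * J := by
  induction p using MvPolynomial.induction_on with
  | C c => simp
  | add p r hp hr =>
    convert add_mem hp hr using 1
    simp only [map_add]
    ring
  | mul_X p s hp =>
    obtain s | t := s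
    -- For `p * X s` both terms with `x` replaced by `0` vanish, so what remains is `x s` times a
    -- first difference of `p` in the variables `y`.
    · convert Ideal.mul_mem_mul (hx s) (aeval_sumElim_sub_mem_right x hy p) using 1
      simp only [map_mul, MvPolynomial.aeval_X, Sum.elim_inl, Pi.zero_apply]
      ring
    · convert Ideal.mul_mem_mul (aeval_sumElim_sub_mem_left hx y p) (hy t) using 1
      simp only [map_mul, MvPolynomial.aeval_X, Sum.elim_inr, Pi.zero_apply]
      ring

end Polynomial

/-! ### Ghost components of vectors with leading zeros -/

section GhostVanishing

variable {O : Type u} [CommRing O] {π : O} {B : Type v} [CommRing B] [Algebra O B] {n : ℕ}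

lemma ghost_eq_of_forall_lt (hq : resCard π ≠ 0) {x : Fin (n + 1) → B} {i : Fin (n + 1)}
    (hx : ∀ j < i, x j = 0) : ghost π x i = algebraMap O B π ^ (i : ℕ) * x i := by
  rw [ghost, Finset.sum_eq_single i]
  · simp
  · intro j hj hji
    rw [hx j (lt_of_le_of_ne (Finset.mem_Iic.1 hj) hji), zero_pow (pow_ne_zero _ hq), mul_zero]
  · simp

/-- Once the earlier components are known to vanish, the `i`-th ghost component is `π ^ i * x i`,
and `π ^ i` can be cancelled. Regularity of `π` is essential: over `π = 0` the ghost components lose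
all but `x 0`. -/
lemma forall_lt_eq_zero_of_ghost (hq : resCard π ≠ 0) (hB : IsLeftRegular (algebraMap O B π))
    {x : Fin (n + 1) → B} {k : ℕ} (h : ∀ i : Fin (n + 1), (i : ℕ) < k → ghost π x i = 0)
    (i : Fin (n + 1)) (hi : (i : ℕ) < k) : x i = 0 := by
  induction i using WellFoundedLT.induction with
  | _ i ih =>
    have h0 := h i hi
    rw [ghost_eq_of_forall_lt hq fun j hj => ih j hj (lt_trans (Fin.lt_def.1 hj) hi)] at h0
    exact (hB.pow i) (by simpa using h0)

lemma ghost_eq_zero_of_forall_lt (hq : resCard π ≠ 0) {x : Fin (n + 1) → B} {k : ℕ}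
    (hx : ∀ i : Fin (n + 1), (i : ℕ) < k → x i = 0) (i : Fin (n + 1)) (hi : (i : ℕ) < k) :
    ghost π x i = 0 := by
  rw [ghost_eq_of_forall_lt hq fun j hj => hx j (lt_trans (Fin.lt_def.1 hj) hi), hx i hi, mul_zero]

/-- The summand `j = 0` is a positive power of `x 0`, and every other one contains `π ^ j = 0`. -/
lemma ghost_eq_zero_of_algebraMap_eq_zero (hq : resCard π ≠ 0) (hπ : algebraMap O B π = 0)
    {x : Fin (n + 1) → B} (hx : x 0 = 0) (i : Fin (n + 1)) : ghost π x i = 0 := by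
  refine Finset.sum_eq_zero fun j _ => ?_
  by_cases hj : j = 0
  · rw [hj, hx, zero_pow (pow_ne_zero _ hq), mul_zero]
  · rw [hπ, zero_pow (fun h => hj (Fin.ext h)), zero_mul]

end GhostVanishing

/-! ### Witt vectors with leading zeros, and the kernel of the projection when `π = 0` -/

namespace Witt

variable {O : Type u} [CommRing O] {π : O} [Fact (Prime π)] [Finite (O ⧸ Ideal.span {π})]
  {n : ℕ} {B : Type v} [CommRing B] [Algebra O B]

lemma resCard_ne_zero : resCard π ≠ 0 := (zero_lt_one.trans (one_lt_resCard π)).ne'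

/-- Every Witt vector lifts to one over a polynomial ring, with the same vanishing components. -/
lemma exists_lift_support (x : Witt π n B) :
    ∃ y : Witt π n (MvPolynomial B O),
      mapFun (MvPolynomial.aeval (R := O) (id : B → B)) y = x ∧
        ∀ i, x.coeff i = 0 → y.coeff i = 0 := by
  classical
  refine ⟨⟨fun i => if x.coeff i = 0 then 0 else MvPolynomial.X (x.coeff i)⟩, ?_, ?_⟩
  · ext i
    simp only [mapFun]
    split_ifs with h <;> simp [h]
  · intro i hi
    simp [hi]

variable [IsDomain O]

/-- Leading zeros and vanishing leading ghost components are equivalent only where `π` is regular,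
which may fail in `B`. Both vectors are therefore lifted, zeros included, to a polynomial ring over
`O`; there additivity of the ghost map decides, and the result is pushed back to `B`. -/
lemma add_coeff_eq_zero {x y : Witt π n B} {k : ℕ}
    (hx : ∀ i : Fin (n + 1), (i : ℕ) < k → x.coeff i = 0)
    (hy : ∀ i : Fin (n + 1), (i : ℕ) < k → y.coeff i = 0) (i : Fin (n + 1)) (hi : (i : ℕ) < k) :
    (x + y).coeff i = 0 := by
  obtain ⟨x, rfl, hx'⟩ := exists_lift_support x
  obtain ⟨y, rfl, hy'⟩ := exists_lift_support y
  have h : (x + y).coeff i = 0 := by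
    refine forall_lt_eq_zero_of_ghost resCard_ne_zero (isLeftRegular_MvPolynomial π)
      (fun i hi => ?_) i hi
    have hxi := ghost_eq_zero_of_forall_lt (resCard_ne_zero (π := π)) (fun i hi => hx' i (hx i hi)) i hi
    have hyi := ghost_eq_zero_of_forall_lt (resCard_ne_zero (π := π)) (fun i hi => hy' i (hy i hi)) i hi
    refine (congrFun (gh_add x y) i).trans ?_
    rw [Pi.add_apply, gh, gh, hxi, hyi, add_zero]
  rw [← mapFun_add]
  exact (congrArg _ h).trans (map_zero _)

lemma mul_coeff_eq_zero (x : Witt π n B) {y : Witt π n B} {k : ℕ}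
    (hy : ∀ i : Fin (n + 1), (i : ℕ) < k → y.coeff i = 0) (i : Fin (n + 1)) (hi : (i : ℕ) < k) :
    (x * y).coeff i = 0 := by
  obtain ⟨x, rfl⟩ := exists_lift x
  obtain ⟨y, rfl, hy'⟩ := exists_lift_support y
  have h : (x * y).coeff i = 0 := by
    refine forall_lt_eq_zero_of_ghost resCard_ne_zero (isLeftRegular_MvPolynomial π)
      (fun i hi => ?_) i hi
    have hyi := ghost_eq_zero_of_forall_lt (resCard_ne_zero (π := π)) (fun i hi => hy' i (hy i hi)) i hi
    refine (congrFun (gh_mul x y) i).trans ?_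
    rw [Pi.mul_apply, gh, gh, hyi, mul_zero]
  rw [← mapFun_mul]
  exact (congrArg _ h).trans (map_zero _)

/-- The leading component of a product `x * y` is the one of `y` times a ghost component of `x`. -/
lemma mul_coeff_of_forall_lt (x : Witt π n B) {y : Witt π n B} {i : Fin (n + 1)}
    (hy : ∀ j < i, y.coeff j = 0) : (x * y).coeff i = x.gh i * y.coeff i := by
  obtain ⟨x, rfl⟩ := exists_lift x
  obtain ⟨y, rfl, hy'⟩ := exists_lift_support y
  have hy'' : ∀ j < i, y.coeff j = 0 := fun j hj => hy' j (hy j hj)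
  have h : (x * y).coeff i = x.gh i * y.coeff i := by
    have h1 := congrFun (gh_mul x y) i
    rw [Pi.mul_apply, gh, gh.eq_1 y, ghost_eq_of_forall_lt resCard_ne_zero hy'',
      ghost_eq_of_forall_lt resCard_ne_zero fun j hj =>
        mul_coeff_eq_zero x (k := i) (fun l hl => hy'' l hl) j hj] at h1
    -- As `y` and `x * y` both vanish below `i`, the multiplicativity of the `i`-th ghost component
    -- reads `π ^ i (x * y)_i = wᵢ(x) π ^ i y_i`; the factor `π ^ i` is cancelled in the polynomial
    -- ring.
    exact ((isLeftRegular_MvPolynomial π).pow i) (h1.trans (mul_left_comm _ _ _))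
  rw [← mapFun_mul]
  refine (congrArg (MvPolynomial.aeval (R := O) (id : B → B)) h).trans ?_
  rw [map_mul, gh, map_ghost]
  rfl

variable (π n B) in
/-- The ideal of the Witt vectors whose first `k` components vanish. -/
noncomputable def vanishingIdeal (k : ℕ) : Ideal (Witt π n B) where
  carrier := {x | ∀ i : Fin (n + 1), (i : ℕ) < k → x.coeff i = 0}
  zero_mem' _ _ := rfl
  add_mem' := add_coeff_eq_zero
  smul_mem' x _ hy := mul_coeff_eq_zero x hy

lemma ker_proj_mul_vanishingIdeal_le (hπ : algebraMap O B π = 0) (k : ℕ) :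
    RingHom.ker (proj : Witt π n B →+* B) * vanishingIdeal π n B k ≤
      vanishingIdeal π n B (k + 1) := by
  refine Ideal.mul_le.2 fun x hx y hy i hi => ?_
  -- Here `i ≤ k`, so `y` vanishes strictly below `i` and the leading-component formula applies even
  -- in the new position `i = k`; its factor `wᵢ(x)` is zero.
  rw [mul_coeff_of_forall_lt x fun j hj => hy j (by have := Fin.lt_def.1 hj; omega), gh,
    ghost_eq_zero_of_algebraMap_eq_zero resCard_ne_zero hπ hx, zero_mul]

/-- Each factor from the kernel forces one more leading zero, and a vector has only `n + 1`
components. -/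
lemma ker_proj_pow_eq_bot (hπ : algebraMap O B π = 0) :
    RingHom.ker (proj : Witt π n B →+* B) ^ (n + 1) = ⊥ := by
  have h : ∀ k, RingHom.ker (proj : Witt π n B →+* B) ^ k ≤ vanishingIdeal π n B k := by
    intro k
    induction k with
    | zero => exact fun x _ i hi => absurd hi (Nat.not_lt_zero _)
    | succ k ih =>
      rw [pow_succ']
      exact (Ideal.mul_mono_right ih).trans (ker_proj_mul_vanishingIdeal_le hπ k)
  exact eq_bot_iff.2 fun x hx => Witt.ext (funext fun i => h _ hx i i.2)

/-! ### Witt vectors over an ideal, and the kernel of the projection when `π` is nilpotent -/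

variable (π n) in
/-- The ideal `Wₙ(I)` of the Witt vectors with components in `I`. -/
noncomputable def idealOf (I : Ideal B) : Ideal (Witt π n B) :=
  RingHom.ker (map (Ideal.Quotient.mkₐ O I) : Witt π n B →+* Witt π n (B ⧸ I))

lemma mem_idealOf {I : Ideal B} {x : Witt π n B} : x ∈ idealOf π n I ↔ ∀ i, x.coeff i ∈ I := by
  rw [idealOf, RingHom.mem_ker, Witt.ext_iff, funext_iff]
  exact forall_congr' fun i => Ideal.Quotient.eq_zero_iff_mem

/-- The identities `x * 0 = 0 * y = 0 * 0 = 0` say that the multiplication polynomials vanish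
whenever one argument is zero. Their value at `(x, y)` is thus its own mixed second difference,
which lies in `I * J`. -/
lemma idealOf_mul_le (I J : Ideal B) :
    idealOf π n I * idealOf π n J ≤ idealOf π n (I * J) := by
  refine Ideal.mul_le.2 fun x hx y hy => mem_idealOf.2 fun i => ?_
  have h := aeval_sumElim_mixed_mem (mem_idealOf.1 hx) (mem_idealOf.1 hy) (mulPoly π n i)
  have h1 : MvPolynomial.aeval (Sum.elim x.coeff 0) (mulPoly π n i) = 0 :=
    congrArg (fun z : Witt π n B => z.coeff i) (mul_zero x)
  have h2 : MvPolynomial.aeval (Sum.elim 0 y.coeff) (mulPoly π n i) = 0 :=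
    congrArg (fun z : Witt π n B => z.coeff i) (zero_mul y)
  have h3 : MvPolynomial.aeval (Sum.elim (0 : Fin (n + 1) → B) (0 : Fin (n + 1) → B))
      (mulPoly π n i) = 0 :=
    congrArg (fun z : Witt π n B => z.coeff i) (zero_mul (0 : Witt π n B))
  rwa [h1, h2, h3, sub_zero, sub_zero, add_zero] at h

lemma idealOf_pow_le (I : Ideal B) (k : ℕ) : idealOf π n I ^ k ≤ idealOf π n (I ^ k) := by
  induction k with
  | zero =>
    intro x _
    exact mem_idealOf.2 fun i => by simp
  | succ k ih =>
    rw [pow_succ, pow_succ]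
    exact (Ideal.mul_mono_left ih).trans (idealOf_mul_le _ _)

/-- If `π` is nilpotent in `B`, then the kernel of `Wₙ(B) → B` is nilpotent. -/
theorem isNilpotent_ker_proj {m : ℕ} (hπ : algebraMap O B π ^ m = 0) :
    IsNilpotent (RingHom.ker (proj : Witt π n B →+* B)) := by
  let I : Ideal B := Ideal.span {algebraMap O B π}
  have hI : I ^ m = ⊥ := by rw [Ideal.span_singleton_pow, hπ, Ideal.span_singleton_eq_bot]
  have h0 : algebraMap O (B ⧸ I) π = 0 :=
    Ideal.Quotient.eq_zero_iff_mem.2 (Ideal.mem_span_singleton_self _)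
  have h1 : RingHom.ker (proj : Witt π n B →+* B) ^ (n + 1) ≤ idealOf π n I := by
    -- `idealOf π n I` unfolds to the preimage of `⊥` under `Wₙ(B) → Wₙ(B/I)`. It suffices that the
    -- image of the power vanishes, and the image of the kernel lies in the corresponding kernel
    -- over `B/I`, where `π = 0`.
    refine Ideal.map_le_iff_le_comap.1 ?_
    rw [Ideal.map_pow]
    refine (Ideal.pow_right_mono ?_ _).trans (ker_proj_pow_eq_bot h0).le
    refine Ideal.map_le_iff_le_comap.2 fun x hx => ?_
    exact (congrArg (Ideal.Quotient.mk I) hx).trans (map_zero _)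
  -- The power `n + 1` moves the kernel into `Wₙ(I)`; a further power `m` moves it into `Wₙ(I ^ m) =
  -- Wₙ(0) = 0`.
  refine ⟨(n + 1) * m, ?_⟩
  rw [pow_mul]
  refine eq_bot_iff.2 (((Ideal.pow_right_mono h1 m).trans (idealOf_pow_le I m)).trans ?_)
  rw [hI]
  exact fun x hx => Witt.ext (funext fun i => mem_idealOf.1 hx i)

end Witt

/-! ### The comparison map on sections -/

namespace ProlongationSequence

variable {O : Type u} [CommRing O] [IsDomain O] {π : O} [Fact (Prime π)]
  [Finite (O ⧸ Ideal.span {π})] (C : ProlongationSequence.{u, v} π) (n : ℕ)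

lemma wittProj_surjective (B : CommAlgCat.{v} (C.obj n)) :
    Function.Surjective ((C.wittProj n).app B).hom :=
  fun b => ⟨(⟨fun _ => b⟩ : Witt π n B), rfl⟩

lemma isNilpotent_ker_wittProj {m : ℕ} (B : CommAlgCat.{v} (C.obj n))
    (hB : algebraMap (C.obj n) B (algebraMap O (C.obj n) π) ^ m = 0) :
    IsNilpotent (RingHom.ker ((C.wittProj n).app B).hom) :=
  letI := C.algebraBase n B
  Witt.isNilpotent_ker_proj (π := π) (n := n) (B := B) (m := m) hB

/-- The square comparing `Jⁿ X → Jⁿ Y` with `X⁽ⁿ⁾ → Y⁽ⁿ⁾` is Cartesian on `B`-sections if `π` is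
nilpotent in `B`. -/
lemma isPullback_jetProj_app {X Y : PreSp.{w} (C.obj 0)} {f : X ⟶ Y} (hf : IsFormallyEtale f)
    {m : ℕ} (B : CommAlgCat.{v} (C.obj n))
    (hB : algebraMap (C.obj n) B (algebraMap O (C.obj n) π) ^ m = 0) :
    IsPullback (((C.jetSpace n).map f).app (op (op B))) (((C.jetProj n).app X).app (op (op B)))
      (((C.jetProj n).app Y).app (op (op B))) (((C.pull n).map f).app (op (op B))) := by
  -- Formal étaleness is applied to the thickening `Spec B → Spec Wₙ(B)`.
  have key := hf ((C.wittProj n).app B) (C.wittProj_surjective n B)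
    (C.isNilpotent_ker_wittProj n B hB)
  rw [Types.isPullback_iff]
  refine ⟨congrArg (fun g => g.app (op (op B))) ((C.jetProj n).naturality f), ?_, ?_⟩
  · intro x₁ x₂ ⟨h₁, h₂⟩
    -- Both `x₁` and `x₂` solve the lifting problem posed by the images of `x₂`, so uniqueness
    -- identifies them.
    refine (key (((C.jetProj n).app X).app (op (op B)) x₂)
      (((C.jetSpace n).map f).app (op (op B)) x₂) ?_).unique ⟨h₂, h₁⟩ ⟨rfl, rfl⟩
    exact (congrArg (fun g => g.app (op (op B)) x₂) ((C.jetProj n).naturality f)).symm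
  · intro y x h
    obtain ⟨z, hz, -⟩ := key x y h.symm
    exact ⟨z, hz.2, hz.1⟩

/-- Limits of presheaves are computed sectionwise, so evaluation at `B` keeps the chosen pullback a
pullback. The comparison map becomes the canonical isomorphism between two pullbacks of the same
diagram of sets. -/
lemma isIso_jetComparison_app {X Y : PreSp.{w} (C.obj 0)} {f : X ⟶ Y} (hf : IsFormallyEtale f)
    {m : ℕ} (B : CommAlgCat.{v} (C.obj n))
    (hB : algebraMap (C.obj n) B (algebraMap O (C.obj n) π) ^ m = 0) :
    IsIso ((C.jetComparison n f).app (op (op B))) := by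
  have h₁ := C.isPullback_jetProj_app n hf B hB
  have h₂ := (IsPullback.of_hasPullback ((C.jetProj n).app Y) ((C.pull n).map f)).map
    ((evaluation _ _).obj (op (op B)))
  have h : (C.jetComparison n f).app (op (op B)) = (h₁.isoIsPullback _ _ h₂).hom := by
    refine h₂.hom_ext ?_ ?_
    · exact (NatTrans.congr_app (pullback.lift_fst _ _ _) (op (op B))).trans
        (IsPullback.isoIsPullback_hom_fst _ _ h₁ h₂).symm
    · exact (NatTrans.congr_app (pullback.lift_snd _ _ _) (op (op B))).trans
        (IsPullback.isoIsPullback_hom_snd _ _ h₁ h₂).symm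
  rw [h]
  infer_instance

end ProlongationSequence

end PiJet

theorem proposition3p7 {O : Type u} [CommRing O] [IsDedekindDomain O] (π : O)
    [Fact (Prime π)] [Finite (O ⧸ Ideal.span {π})]
    (R : PiJet.ProlongationSequence.{u, v} π)
    (X Y : PiJet.Sp.{w, v} (R.obj 0)) (f : X ⟶ Y) (hf : PiJet.IsFormallyEtale f.hom) (n m : ℕ) :
    IsIso ((R.reduceMod n m).map (R.jetComparison n f.hom)) := by
  rw [NatTrans.isIso_iff_isIso_app]
  intro B
  refine R.isIso_jetComparison_app n hf (m := m)
    ((PiJet.restrictScalars (Ideal.Quotient.mk _)).obj B.unop.unop) ?_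
  -- The `Rₙ`-algebra structure of `B` factors through `Rₙ / π ^ m Rₙ`, where `π ^ m` is already
  -- zero.
  change algebraMap (R.modPow n m) B.unop.unop
    (Ideal.Quotient.mk _ (algebraMap O (R.obj n) π)) ^ m = 0
  have h : (Ideal.Quotient.mk (Ideal.span {algebraMap O (R.obj n) π ^ m}))
      (algebraMap O (R.obj n) π) ^ m = 0 := by
    exact Ideal.Quotient.eq_zero_iff_mem.2 (Ideal.mem_span_singleton_self
      (algebraMap O (R.obj n) π ^ m))
  exact (map_pow (algebraMap (R.modPow n m) B.unop.unop) _ _).symm.trans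
    ((congrArg _ h).trans (map_zero _))
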